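/- Let $G$ be a finite simple graph with vertex set $V$ and adjacency matrix $A(G)$. An arithmetical structure on $G$ is a pair $(\mathbf d,\mathbf r)$, where $\mathbf d\in\mathbb Z_{\ge 0}^{V}$ and $\mathbf r\in\mathbb Z_{>0}^{V}$ has entries with no nontrivial common factor, such that $(\operatorname{diag}(\mathbf d)-A(G))\,\mathbf r=\mathbf 0$. Its critical group is the torsion subgroup of the cokernel $\mathbb Z^{V}/\operatorname{im}(\operatorname{diag}(\mathbf d)-A(G))$. A starlike tree is a finite tree with exactly one vertex of degree at least $3$, its central vertex; its tentacles are the paths from the central vertex to the leaves, and the length of a tentacle is its number of edges. For $j\ge 2$, a broom graph with $j$ prongs is a starlike tree with exactly $j+1$ tentacles, at most one of which has length greater than $1$. The invariant factors of a finite abelian group $\mathcal G$ are the integers $\alpha_1,\dots,\alpha_k\ge 2$ with $\alpha_i\mid\alpha_{i+1}$ for $1\le i<k$ and $\mathcal G\cong\mathbb Z/\alpha_1\mathbb Z\oplus\cdots\oplus\mathbb Z/\alpha_k\mathbb Z$ (with $k=0$ for the trivial group). (a) Let $m$ be a positive integer, and let $\mathcal G$ be a finite abelian group with at most $m$ invariant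 factors. Then there are a broom graph with $m+1$ prongs and an arithmetical structure on it whose critical group is isomorphic to $\mathcal G$. (b) In particular, for every finite abelian group $\mathcal G$ there are a finite tree and an arithmetical structure on it whose critical group is isomorphic to $\mathcal G$. -/

import Mathlib

open Matrix

/-- An arithmetical structure `(d, r)` on a finite graph: nonnegative integers `d v` and positive
integers `r v` with no common factor, such that `(diag d - A) r = 0`, where `A` is the adjacency
matrix. -/
structure ArithmeticalStructure {V : Type*} [Fintype V] [DecidableEq V]
    (G : SimpleGraph V) [DecidableRel G.Adj] where
  d : V → ℕ
  r : V → ℕ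
  r_pos : ∀ v, 0 < r v
  gcd_r : Finset.univ.gcd r = 1
  laplacian_mulVec_r :
    (Matrix.diagonal (fun v => (d v : ℤ)) - G.adjMatrix ℤ) *ᵥ (fun v => (r v : ℤ)) = 0

namespace ArithmeticalStructure

variable {V : Type*} [Fintype V] [DecidableEq V] {G : SimpleGraph V} [DecidableRel G.Adj]

/-- The generalized Laplacian matrix `L(G, d) = diag d - A`. -/
def laplacian (S : ArithmeticalStructure G) : Matrix V V ℤ :=
  Matrix.diagonal (fun v => (S.d v : ℤ)) - G.adjMatrix ℤ

/-- The cokernel `ℤ^V / im L(G, d)` of the generalized Laplacian matrix. -/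
abbrev Cokernel (S : ArithmeticalStructure G) : Type _ :=
  (V → ℤ) ⧸ LinearMap.range S.laplacian.mulVecLin

/-- The critical group: the torsion subgroup of the cokernel of the generalized Laplacian. -/
abbrev CriticalGroup (S : ArithmeticalStructure G) : Type _ :=
  AddCommGroup.torsion S.Cokernel

end ArithmeticalStructure

/-- `α 0 ∣ α 1 ∣ ⋯` are the invariant factors of the finite abelian group `A`: each is at least
`2`, each divides the next, and `A ≅ ⨁ i, ℤ/(α i)ℤ`. The trivial group has none (`k = 0`). -/
structure IsInvariantFactors (A : Type*) [AddCommGroup A] {k : ℕ} (α : Fin k → ℕ) : Prop where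
  two_le : ∀ i, 2 ≤ α i
  dvd : ∀ i j, i ≤ j → α i ∣ α j
  equiv : Nonempty (A ≃+ ((i : Fin k) → ZMod (α i)))

/-- The finite abelian group `A` has at most `m` invariant factors. -/
def HasAtMostInvariantFactors (A : Type*) [AddCommGroup A] (m : ℕ) : Prop :=
  ∃ k ≤ m, ∃ α : Fin k → ℕ, IsInvariantFactors A α

namespace SimpleGraph

variable {V : Type*} [Fintype V] (G : SimpleGraph V) [DecidableRel G.Adj]

/-- `G` is a starlike tree with central vertex `c`: a tree in which `c` is the one and only vertex
of degree at least `3`. -/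
structure IsStarlikeTree (c : V) : Prop where
  isTree : G.IsTree
  three_le_degree_iff : ∀ v, 3 ≤ G.degree v ↔ v = c

variable {G} in
/-- A tentacle: a path with at least one edge, from a vertex whose degree is not `2` to a leaf,
all of whose inner vertices have degree `2`. Its length is its number of edges, i.e. its number of
vertices other than the starting vertex. -/
structure IsTentacle {u v : V} (p : G.Walk u v) : Prop where
  isPath : p.IsPath
  length_pos : 0 < p.length
  degree_start : G.degree u ≠ 2
  degree_end : G.degree v = 1
  degree_inner : ∀ w ∈ p.support, w ≠ u → w ≠ v → G.degree w = 2

/-- The tentacles of `G` that start at `c`, each recorded with its leaf. In a starlike tree with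
central vertex `c` these are all the tentacles. -/
def tentaclesFrom (c : V) : Set (Σ v : V, G.Walk c v) :=
  {t | IsTentacle t.2}

/-- `G` is a broom graph with `j` prongs: a starlike tree with `j + 1` tentacles, at most one of
which has length greater than `1`. -/
def IsBroomGraph (j : ℕ) : Prop :=
  ∃ c, G.IsStarlikeTree c ∧ (G.tentaclesFrom c).ncard = j + 1 ∧
    {t ∈ G.tentaclesFrom c | 1 < t.2.length}.Subsingleton

end SimpleGraph

/-! Given `α i` with product `P`, write `P = α i * β i`. Around a center with `r = P ^ 2`, put a
leaf with `d = α i`, `r = P * β i` for each `i`, and an extra leaf with `d = P ^ 2`, `r = 1`.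
Balance at the center then forces the next value `t` on a long tentacle; `t` is prime to `P`, so a
Euclidean descent (`Nat.Coprime.exists_divisor_chain`) completes the tentacle. At a leaf, `L g` is
`d` times the leaf value of `g` minus its central value. Hence differences with the extra leaf,
modulo `α i`, kill the image of `L`. If they vanish on some `f` orthogonal to `r`, then `L g = f` is
solved outward from the leaves. By `nonempty_criticalGroup_equiv`, these differences identify the
critical group with the product of the `ZMod (α i)`. -/

namespace SimpleGraph

/-! ### Tentacles and leaves of starlike trees -/

variable {V : Type*} [Fintype V] {G : SimpleGraph V} [DecidableRel G.Adj] {c : V}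

theorem Walk.IsPath.two_le_degree_of_mem_support {u v w : V} {p : G.Walk u v} (hp : p.IsPath)
    (hw : w ∈ p.support) (hu : w ≠ u) (hv : w ≠ v) : 2 ≤ G.degree w := by
  obtain ⟨i, rfl, hi⟩ := Walk.mem_support_iff_exists_getVert.1 hw
  have h0 : i ≠ 0 := by rintro rfl; simp at hu
  have hl : i ≠ p.length := by rintro rfl; simp at hv
  obtain ⟨j, rfl⟩ := Nat.exists_eq_succ_of_ne_zero h0
  have h1 := p.adj_getVert_succ (i := j) (by omega)
  have h2 := p.adj_getVert_succ (i := j + 1) (by omega)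
  have hne : p.getVert j ≠ p.getVert (j + 1 + 1) := fun h => by
    have := hp.getVert_injOn (by simp; omega) (by simp; omega) h
    omega
  rw [← card_neighborFinset_eq_degree]
  exact Finset.one_lt_card.2 ⟨_, by simpa using h1.symm, _, by simpa using h2, hne⟩

/-- Inner vertices of the path from `c` have degree at least `2`, and below `3` since they are not
`c`. -/
theorem IsStarlikeTree.exists_isTentacle (h : G.IsStarlikeTree c) {v : V} (hv : G.degree v = 1) :
    ∃ p : G.Walk c v, IsTentacle p := by
  have hc : 3 ≤ G.degree c := (h.three_le_degree_iff c).2 rfl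
  obtain ⟨p, hp, -⟩ := h.isTree.existsUnique_path c v
  refine ⟨p, hp, ?_, by omega, hv, fun w hw hwc hwv => ?_⟩
  · rw [Nat.pos_iff_ne_zero]
    intro h0
    have := Walk.eq_of_length_eq_zero h0
    subst this
    omega
  · have h2 := hp.two_le_degree_of_mem_support hw hwc hwv
    have h3 := mt (h.three_le_degree_iff w).1 hwc
    omega

theorem IsTree.tentaclesFrom_ext (h : G.IsTree) {s t : Σ v : V, G.Walk c v}
    (hs : s ∈ G.tentaclesFrom c) (ht : t ∈ G.tentaclesFrom c) (hst : s.1 = t.1) : s = t := by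
  obtain ⟨v, p⟩ := s
  obtain ⟨w, q⟩ := t
  obtain rfl : v = w := hst
  obtain rfl : p = q := (h.existsUnique_path c v).unique hs.isPath ht.isPath
  rfl

theorem IsStarlikeTree.ncard_tentaclesFrom (h : G.IsStarlikeTree c) :
    (G.tentaclesFrom c).ncard = {v | G.degree v = 1}.ncard := by
  refine Set.ncard_congr (fun t _ => t.1) (fun t ht => ht.degree_end)
    (fun s t hs ht hst => h.isTree.tentaclesFrom_ext hs ht hst) fun v hv => ?_
  obtain ⟨p, hp⟩ := h.exists_isTentacle hv
  exact ⟨⟨v, p⟩, hp, rfl⟩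

/-- A starlike tree is a broom as soon as all but one of its leaves are adjacent to the center. -/
theorem IsStarlikeTree.isBroomGraph (h : G.IsStarlikeTree c) {j : ℕ}
    (hj : {v | G.degree v = 1}.ncard = j + 1) (z : V)
    (hz : ∀ v, G.degree v = 1 → v ≠ z → G.Adj c v) : G.IsBroomGraph j := by
  refine ⟨c, h, h.ncard_tentaclesFrom.trans hj, ?_⟩
  have key : ∀ t ∈ G.tentaclesFrom c, 1 < t.2.length → t.1 = z := by
    intro t ht hl
    by_contra hne
    have hadj := hz t.1 ht.degree_end hne
    have hp : (Walk.cons hadj Walk.nil).IsPath := by simp [hadj.ne]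
    rw [(h.isTree.existsUnique_path c t.1).unique ht.isPath hp] at hl
    simp at hl
  rintro s ⟨hs, hs1⟩ t ⟨ht, ht1⟩
  exact h.isTree.tentaclesFrom_ext hs ht ((key s hs hs1).trans (key t ht ht1).symm)

/-! ### Brooms -/

/-- The path `0, 1, …, L + 1` with a leaf attached to `0` for each element of `κ`. -/
def broom (κ : Type*) (L : ℕ) : SimpleGraph (κ ⊕ Fin (L + 2)) where
  Adj
    | .inl _, .inl _ => False
    | .inl _, .inr a => a = 0
    | .inr a, .inl _ => a = 0
    | .inr a, .inr b => a.val + 1 = b.val ∨ b.val + 1 = a.val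
  symm := ⟨by
    rintro (i | a) (j | b) h
    · exact h
    · exact h
    · exact h
    · exact h.symm⟩
  loopless := ⟨by
    rintro (i | a) h
    · exact h
    · rcases h with h | h <;> omega⟩

namespace broom

variable {κ : Type*} {L : ℕ}

instance : DecidableRel (broom κ L).Adj
  | .inl _, .inl _ => inferInstanceAs (Decidable False)
  | .inl _, .inr a => inferInstanceAs (Decidable (a = 0))
  | .inr a, .inl _ => inferInstanceAs (Decidable (a = 0))
  | .inr a, .inr b => inferInstanceAs (Decidable (a.val + 1 = b.val ∨ b.val + 1 = a.val))

@[simp] theorem not_adj_inl_inl (i j : κ) : ¬ (broom κ L).Adj (.inl i) (.inl j) := id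

@[simp] theorem adj_inl_inr {i : κ} {a : Fin (L + 2)} :
    (broom κ L).Adj (.inl i) (.inr a) ↔ a = 0 := Iff.rfl

@[simp] theorem adj_inr_inl {i : κ} {a : Fin (L + 2)} :
    (broom κ L).Adj (.inr a) (.inl i) ↔ a = 0 := Iff.rfl

@[simp] theorem adj_inr_inr {a b : Fin (L + 2)} :
    (broom κ L).Adj (.inr a) (.inr b) ↔ a.val + 1 = b.val ∨ b.val + 1 = a.val := Iff.rfl

/-- Case analysis on the vertices of a broom. -/
theorem vertex_cases {motive : κ ⊕ Fin (L + 2) → Prop} (leaf : ∀ j, motive (.inl j))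
    (center : motive (.inr 0)) (inner : ∀ i : Fin L, motive (.inr i.castSucc.succ))
    (last : motive (.inr (Fin.last L).succ)) (v : κ ⊕ Fin (L + 2)) : motive v := by
  rcases v with j | a
  · exact leaf j
  · refine Fin.cases center (fun i => ?_) a
    exact Fin.lastCases last inner i

theorem connected : (broom κ L).Connected := by
  have h : ∀ a : Fin (L + 2), (broom κ L).Reachable (.inr 0) (.inr a) := by
    intro a
    induction a using Fin.induction with
    | zero => rfl
    | succ i ih => exact ih.trans (Adj.reachable (by simp))
  have h' : ∀ v, (broom κ L).Reachable (.inr 0) v := by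
    rintro (j | a)
    · exact Adj.reachable (by simp)
    · exact h a
  exact { preconnected := fun u v => (h' u).symm.trans (h' v), nonempty := ⟨.inr 0⟩ }

variable [Fintype κ] {M : Type*} [AddCommMonoid M] (f : κ ⊕ Fin (L + 2) → M)

/-- With a general `f`, these sums give both the degrees (`f = 1`) and the Laplacian. -/
theorem sum_neighborFinset_inl (j : κ) :
    ∑ u ∈ (broom κ L).neighborFinset (.inl j), f u = f (.inr 0) := by
  have : (broom κ L).neighborFinset (.inl j) = {.inr 0} := by
    ext (i | a) <;> simp
  simp [this]

theorem sum_neighborFinset_center :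
    ∑ u ∈ (broom κ L).neighborFinset (.inr 0), f u = ∑ j, f (.inl j) + f (.inr 1) := by
  have : (broom κ L).neighborFinset (.inr 0) = Finset.univ.disjSum {1} := by
    ext (i | a)
    · simp
    · rw [mem_neighborFinset, adj_inr_inr, Finset.inr_mem_disjSum, Finset.mem_singleton,
        Fin.ext_iff, Fin.val_zero, Fin.val_one]
      omega
  simp [this, Finset.sum_disjSum]

theorem sum_neighborFinset_inner (i : Fin L) :
    ∑ u ∈ (broom κ L).neighborFinset (.inr i.castSucc.succ), f u =
      f (.inr i.castSucc.castSucc) + f (.inr i.succ.succ) := by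
  classical
  have : (broom κ L).neighborFinset (.inr i.castSucc.succ) =
      {.inr i.castSucc.castSucc, .inr i.succ.succ} := by
    ext (j | a) <;> simp [Fin.ext_iff]
    omega
  rw [this, Finset.sum_pair]
  simp [Fin.ext_iff]
  omega

theorem sum_neighborFinset_last :
    ∑ u ∈ (broom κ L).neighborFinset (.inr (Fin.last L).succ), f u =
      f (.inr (Fin.last L).castSucc) := by
  have : (broom κ L).neighborFinset (.inr (Fin.last L).succ) =
      {.inr (Fin.last L).castSucc} := by
    ext (j | a) <;> simp [Fin.ext_iff]
    omega
  rw [this, Finset.sum_singleton]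

theorem degree_inl (j : κ) : (broom κ L).degree (.inl j) = 1 := by
  rw [← card_neighborFinset_eq_degree, Finset.card_eq_sum_ones, sum_neighborFinset_inl]

theorem degree_center : (broom κ L).degree (.inr 0) = Fintype.card κ + 1 := by
  rw [← card_neighborFinset_eq_degree, Finset.card_eq_sum_ones, sum_neighborFinset_center]
  simp

theorem degree_inner (i : Fin L) : (broom κ L).degree (.inr i.castSucc.succ) = 2 := by
  rw [← card_neighborFinset_eq_degree, Finset.card_eq_sum_ones, sum_neighborFinset_inner]

theorem degree_last : (broom κ L).degree (.inr (Fin.last L).succ) = 1 := by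
  rw [← card_neighborFinset_eq_degree, Finset.card_eq_sum_ones, sum_neighborFinset_last]

theorem isTree : (broom κ L).IsTree := by
  rw [isTree_iff_connected_and_card]
  refine ⟨connected, ?_⟩
  have h := (broom κ L).sum_degrees_eq_twice_card_edges
  rw [Fintype.sum_sum_type, Fin.sum_univ_succ, Fin.sum_univ_castSucc] at h
  simp only [degree_inl, degree_center, degree_inner, degree_last] at h
  rw [Nat.card_eq_fintype_card, Nat.card_eq_fintype_card, ← edgeFinset_card]
  simp at h ⊢
  omega

theorem isBroomGraph (hκ : 2 ≤ Fintype.card κ) :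
    (broom κ L).IsBroomGraph (Fintype.card κ) := by
  have hs : (broom κ L).IsStarlikeTree (.inr 0) := by
    refine ⟨isTree, vertex_cases (fun j => ?_) ?_ (fun i => ?_) ?_⟩
    · simp [degree_inl]
    · simpa [degree_center] using hκ
    · simp [degree_inner, Fin.ext_iff]
    · simp [degree_last, Fin.ext_iff, -Fin.succ_last]
  refine hs.isBroomGraph (z := .inr (Fin.last L).succ) ?_ (vertex_cases ?_ ?_ ?_ ?_)
  · have : {v | (broom κ L).degree v = 1} =
        ((Finset.univ.disjSum {(Fin.last L).succ} : Finset (κ ⊕ Fin (L + 2))) : Set _) := by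
      ext v
      refine vertex_cases (motive := fun v => v ∈ _ ↔ v ∈ _) (fun j => ?_) ?_ (fun i => ?_) ?_ v
      · simp [degree_inl]
      · have : Fintype.card κ ≠ 0 := by omega
        simpa [degree_center, Fin.ext_iff] using this
      · simp [degree_inner, Fin.ext_iff]
        omega
      · simp [degree_last, -Fin.succ_last]
    rw [this, Set.ncard_coe_finset]
    simp [Finset.card_disjSum]
  · simp
  · intro h
    rw [degree_center] at h
    omega
  · intro i h
    rw [degree_inner] at h
    omega
  · simp

end broom

end SimpleGraph

/-! ### Divisor chains and recurrences -/

/-- Coprime `a, b` start a sequence of positive integers, each dividing the sum of its neighbors,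
that ends in `1, 0`. -/
theorem Nat.Coprime.exists_divisor_chain {a b : ℕ} (ha : 0 < a) (hb : 0 < b)
    (hab : a.Coprime b) :
    ∃ (L : ℕ) (ρ δ : ℕ → ℕ), ρ 0 = a ∧ ρ 1 = b ∧ ρ (L + 1) = 1 ∧ ρ (L + 2) = 0 ∧
      (∀ i ≤ L, δ i * ρ (i + 1) = ρ i + ρ (i + 2)) ∧ ∀ i ≤ L + 1, 0 < ρ i := by
  induction b using Nat.strong_induction_on generalizing a with
  | _ b ih =>
    rcases eq_or_ne b 1 with rfl | hb1
    · refine ⟨0, fun i => if i = 0 then a else if i = 1 then 1 else 0, fun _ => a, ?_⟩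
      refine ⟨rfl, rfl, rfl, rfl, fun i hi => ?_, fun i hi => ?_⟩
      · obtain rfl : i = 0 := by omega
        simp
      · dsimp only
        split_ifs <;> omega
    · have hmod : 0 < a % b := by
        refine Nat.pos_of_ne_zero fun h => hb1 ?_
        exact hab.symm.eq_one_of_dvd (Nat.dvd_of_mod_eq_zero h)
      have hlt := Nat.mod_lt a hb
      have hdiv := Nat.div_add_mod a b
      -- Rounding the quotient up makes the next term `b - a % b`, still positive, smaller than `b`
      -- and prime to it.
      have hc : (a / b + 1) * b = a + (b - a % b) := by
        rw [add_mul, mul_comm (a / b)]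
        omega
      have hcop : b.Coprime (b - a % b) := by
        rw [Nat.coprime_self_sub_right hlt.le]
        rwa [Nat.Coprime, Nat.gcd_comm, ← Nat.gcd_rec, Nat.gcd_comm]
      obtain ⟨L, ρ, δ, h0, h1, h2, h3, h4, h5⟩ :=
        ih (b - a % b) (by omega) hb (by omega) hcop
      refine ⟨L + 1, fun i => Nat.casesOn i a ρ, fun i => Nat.casesOn i (a / b + 1) δ,
        rfl, h0, h2, h3, ?_, ?_⟩
      · rintro (_ | i) hi
        · simpa [h0, h1] using hc
        · exact h4 i (by omega)
      · rintro (_ | i) hi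
        · exact ha
        · exact h5 i (by omega)

/-- A second-order recurrence has a solution with prescribed initial values. -/
theorem exists_recurrence (a b : ℤ) (d e : ℕ → ℤ) :
    ∃ h : ℕ → ℤ, h 0 = a ∧ h 1 = b ∧ ∀ i, h (i + 2) = d i * h (i + 1) - h i - e i := by
  let s : ℕ → ℤ × ℤ := fun n =>
    Nat.rec (a, b) (fun i p => (p.2, d i * p.2 - p.1 - e i)) n
  exact ⟨fun n => (s n).1, rfl, rfl, fun i => rfl⟩

/-! ### Computing critical groups -/

namespace ArithmeticalStructure

variable {V : Type*} [Fintype V] [DecidableEq V] {G : SimpleGraph V} [DecidableRel G.Adj]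
  (S : ArithmeticalStructure G)

theorem laplacian_mulVec_apply (f : V → ℤ) (v : V) :
    (S.laplacian *ᵥ f) v = S.d v * f v - ∑ u ∈ G.neighborFinset v, f u := by
  rw [laplacian, sub_mulVec, Pi.sub_apply, mulVec_diagonal, SimpleGraph.adjMatrix_mulVec_apply]

theorem r_dotProduct_laplacian_mulVec (f : V → ℤ) :
    (fun v => (S.r v : ℤ)) ⬝ᵥ (S.laplacian *ᵥ f) = 0 := by
  have hT : S.laplacianᵀ = S.laplacian := by
    rw [laplacian, transpose_sub, diagonal_transpose, SimpleGraph.transpose_adjMatrix]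
  have h : S.laplacian *ᵥ (fun v => (S.r v : ℤ)) = 0 := S.laplacian_mulVec_r
  rw [dotProduct_mulVec, ← mulVec_transpose, hT, h, zero_dotProduct]

/-- To solve `L g = f` when `r ⬝ f = 0` it suffices to satisfy all equations but one. -/
theorem laplacian_mulVec_eq_of_forall_ne {f g : V → ℤ} (z : V)
    (hf : (fun v => (S.r v : ℤ)) ⬝ᵥ f = 0) (h : ∀ v ≠ z, (S.laplacian *ᵥ g) v = f v) :
    S.laplacian *ᵥ g = f := by
  ext v
  rcases eq_or_ne v z with rfl | hv
  · have h0 : (fun v => (S.r v : ℤ)) ⬝ᵥ (S.laplacian *ᵥ g - f) = 0 := by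
      rw [dotProduct_sub, hf, S.r_dotProduct_laplacian_mulVec, sub_zero]
    rw [dotProduct, Finset.sum_eq_single v (fun u _ hu => by simp [h u hu]) (by simp)] at h0
    simpa [(S.r_pos v).ne', sub_eq_zero] using h0
  · exact h v hv

/-- A homomorphism `θ : ℤ^V → B` to a torsion group whose common kernel with `r ⬝ ·` is the image
of the Laplacian, and which is surjective on vectors orthogonal to `r`, identifies the critical
group with `B`. -/
theorem nonempty_criticalGroup_equiv {B : Type*} [AddCommGroup B] [Finite B]
    (θ : (V → ℤ) →+ B) (hL : ∀ g, θ (S.laplacian *ᵥ g) = 0)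
    (hker : ∀ f, (fun v => (S.r v : ℤ)) ⬝ᵥ f = 0 → θ f = 0 → ∃ g, S.laplacian *ᵥ g = f)
    (hsurj : ∀ b, ∃ f, (fun v => (S.r v : ℤ)) ⬝ᵥ f = 0 ∧ θ f = b) :
    Nonempty (S.CriticalGroup ≃+ B) := by
  let R := LinearMap.range S.laplacian.mulVecLin
  let θ' : S.Cokernel →ₗ[ℤ] B := R.liftQ θ.toIntLinearMap (by
    rintro _ ⟨g, rfl⟩
    exact hL g)
  let φ : S.CriticalGroup →+ B := θ'.toAddMonoidHom.comp (AddCommGroup.torsion S.Cokernel).subtype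
  have hmem : ∀ f : V → ℤ, (∃ g, S.laplacian *ᵥ g = f) → R.mkQ f = 0 := by
    rintro f ⟨g, rfl⟩
    exact (Submodule.Quotient.mk_eq_zero R).2 ⟨g, rfl⟩
  refine ⟨AddEquiv.ofBijective φ ⟨(injective_iff_map_eq_zero φ).2 ?_, fun b => ?_⟩⟩
  · rintro ⟨x, hx⟩ h
    obtain ⟨f, rfl⟩ := R.mkQ_surjective x
    obtain ⟨n, hn, hnx⟩ := isOfFinAddOrder_iff_nsmul_eq_zero.1 hx
    have hrange : n • f ∈ R := by
      rwa [← map_nsmul, Submodule.mkQ_apply, Submodule.Quotient.mk_eq_zero] at hnx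
    obtain ⟨g, hg⟩ := hrange
    -- A multiple of `f` lies in the image, which is orthogonal to `r`.
    have hr : (fun v => (S.r v : ℤ)) ⬝ᵥ f = 0 := by
      have := S.r_dotProduct_laplacian_mulVec g
      rw [show S.laplacian *ᵥ g = n • f from hg, dotProduct_smul] at this
      exact (smul_eq_zero.1 this).resolve_left hn.ne'
    exact Subtype.ext (hmem f (hker f hr h))
  · obtain ⟨f, hf, rfl⟩ := hsurj b
    refine ⟨⟨R.mkQ f, ?_⟩, rfl⟩
    refine isOfFinAddOrder_iff_nsmul_eq_zero.2 ⟨Nat.card B, Nat.card_pos, ?_⟩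
    rw [← map_nsmul]
    refine hmem _ (hker _ ?_ ?_)
    · rw [dotProduct_smul, hf, smul_zero]
    · rw [map_nsmul, card_nsmul_eq_zero']

end ArithmeticalStructure

/-! ### The arithmetical structure on a broom -/

namespace SimpleGraph.broom

open Finset

variable {ι : Type*} [Fintype ι] [DecidableEq ι]

theorem exists_arithmeticalStructure (α : ι → ℕ) (hα : ∀ i, 0 < α i) :
    ∃ (L : ℕ) (S : ArithmeticalStructure (broom (Option ι) L)),
      Nonempty (S.CriticalGroup ≃+ ((i : ι) → ZMod (α i))) := by
  have hdvd : ∀ i, α i ∣ ∏ i, α i := fun i => dvd_prod_of_mem α (mem_univ i)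
  have hP : 0 < ∏ i, α i := prod_pos fun i _ => hα i
  generalize (∏ i, α i) = P at hdvd hP
  choose β hβ using hdvd
  have hβ0 : ∀ i, 0 < β i := fun i => Nat.pos_of_mul_pos_left (hβ i ▸ hP)
  -- This is the equation at the center, divisor `∑ i, β i + 2`; the `+ 2` keeps `t` positive.
  obtain ⟨t, ht0, ht⟩ : ∃ t, 0 < t ∧ (∑ i, β i + 2) * P ^ 2 = P * ∑ i, β i + 1 + t := by
    obtain ⟨t, ht⟩ : ∃ t, (∑ i, β i + 2) * P ^ 2 = P * ∑ i, β i + 2 + t := by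
      refine Nat.exists_eq_add_of_le ?_
      nlinarith [Nat.zero_le (∑ i, β i), Nat.le_self_pow two_ne_zero P]
    exact ⟨t + 1, by omega, by omega⟩
  -- Indeed `t ≡ -1` modulo `P`.
  have hcop : (P ^ 2).Coprime t := by
    refine Nat.Coprime.pow_left 2 (Nat.isCoprime_iff_coprime.1
      ⟨(∑ i, β i + 2) * P - ∑ i, β i, -1, ?_⟩)
    have : ((∑ i, β i + 2) * P ^ 2 : ℤ) = P * ∑ i, β i + 1 + t := by exact_mod_cast ht
    linear_combination this
  obtain ⟨L, ρ, δ, ρ0, ρ1, ρL, ρL', hρ, ρpos⟩ :=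
    hcop.exists_divisor_chain (by positivity) ht0
  let S : ArithmeticalStructure (broom (Option ι) L) :=
    { d := Sum.elim (fun j => j.elim (P ^ 2) α)
        (Fin.cases (∑ i, β i + 2) fun i : Fin (L + 1) => δ i)
      r := Sum.elim (fun j => j.elim 1 fun i => P * β i) fun a => ρ a
      r_pos := by
        rintro ((_ | i) | a)
        · exact one_pos
        · exact Nat.mul_pos hP (hβ0 i)
        · exact ρpos a (by omega)
      gcd_r := Nat.dvd_one.1 (gcd_dvd (mem_univ (Sum.inl none)))
      laplacian_mulVec_r := by
        ext v
        rw [sub_mulVec, Pi.sub_apply, mulVec_diagonal, adjMatrix_mulVec_apply, Pi.zero_apply,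
          sub_eq_zero]
        induction v using vertex_cases with
        | leaf j =>
          rw [sum_neighborFinset_inl]
          rcases j with _ | i
          · simp [ρ0]
          · simp only [Sum.elim_inl, Option.elim_some, Sum.elim_inr, Fin.val_zero, ρ0]
            rw [← Nat.cast_mul, mul_left_comm, ← hβ i, sq]
        | center =>
          rw [sum_neighborFinset_center]
          have : ((∑ i, β i + 2 : ℕ) * (P ^ 2 : ℕ) : ℤ) = (1 + P * ∑ i, β i : ℕ) + t := by
            rw [← Nat.cast_mul, ht]
            push_cast
            ring
          simpa [ρ0, ρ1, ← mul_sum] using this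
        | inner i =>
          rw [sum_neighborFinset_inner]
          exact_mod_cast hρ i i.2.le
        | last =>
          rw [sum_neighborFinset_last]
          have := hρ L le_rfl
          rw [ρL', add_zero] at this
          exact_mod_cast this }
  have hL : ∀ (g : Option ι ⊕ Fin (L + 2) → ℤ) j,
      (S.laplacian *ᵥ g) (.inl j) = (j.elim (P ^ 2) α : ℕ) * g (.inl j) - g (.inr 0) := by
    intro g j
    rw [S.laplacian_mulVec_apply, sum_neighborFinset_inl]
    rfl
  have : ∀ i, NeZero (α i) := fun i => ⟨(hα i).ne'⟩
  let θ : (Option ι ⊕ Fin (L + 2) → ℤ) →+ ((i : ι) → ZMod (α i)) :=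
    { toFun f i := ((f (.inl (some i)) - f (.inl none) : ℤ) : ZMod (α i))
      map_zero' := by ext; simp
      map_add' f g := by ext; simp; ring }
  refine ⟨L, S, S.nonempty_criticalGroup_equiv θ (fun g => ?_) (fun f hf hθ => ?_) fun b => ?_⟩
  · ext i
    have : θ (S.laplacian *ᵥ g) i = ((α i * g (.inl (some i)) - g (.inr 0) -
      ((P ^ 2 : ℕ) * g (.inl none) - g (.inr 0)) : ℤ) : ZMod (α i)) := by
      change (((S.laplacian *ᵥ g) _ - (S.laplacian *ᵥ g) _ : ℤ) : ZMod (α i)) = _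
      rw [hL, hL]
      rfl
    rw [this, hβ i]
    simp
  · have hdiv : ∀ i, ∃ y : ℤ, f (.inl (some i)) - f (.inl none) = α i * y := fun i =>
      (ZMod.intCast_zmod_eq_zero_iff_dvd _ _).1 (congrFun hθ i)
    choose y hy using hdiv
    -- `h 0` solves the equation at the extra leaf, where `g` is `0`; `h 1` solves the one at the
    -- center. The default `0` is never used.
    obtain ⟨h, h0, h1, h2⟩ := exists_recurrence (-f (.inl none))
      ((∑ i, β i + 2 : ℕ) * (-f (.inl none)) - ∑ i, y i - f (.inr 0)) (fun i => δ i)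
      (fun i => if hi : i + 1 < L + 2 then f (.inr ⟨i + 1, hi⟩) else 0)
    refine ⟨Sum.elim (fun j => j.elim 0 y) fun a => h a,
      S.laplacian_mulVec_eq_of_forall_ne (.inr (Fin.last L).succ) hf
        (vertex_cases ?_ ?_ (fun i => ?_) ?_)⟩
    · rintro (_ | i) -
      · rw [hL]
        simp [h0]
      · rw [hL]
        simp [h0, ← hy]
    · intro _
      rw [S.laplacian_mulVec_apply, sum_neighborFinset_center]
      simp [h0, h1, S]
      ring
    · intro _
      rw [S.laplacian_mulVec_apply, sum_neighborFinset_inner]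
      have := h2 i
      rw [dif_pos (by omega)] at this
      change (δ i : ℤ) * h (i + 1) - (h i + h (i + 2)) = _
      rw [this]
      change _ = f (.inr ⟨i + 1, by omega⟩)
      ring
    · simp
  -- Leaf values are free: the far end of the path, where `r = 1` and which `θ` ignores, restores
  -- orthogonality.
  · let f₀ : Option ι ⊕ Fin (L + 2) → ℤ := Sum.elim (fun j => j.elim 0 fun i => (b i).val) 0
    let s := (fun v => (S.r v : ℤ)) ⬝ᵥ f₀
    refine ⟨f₀ - Pi.single (.inr (Fin.last L).succ) s, ?_, ?_⟩
    · have : S.r (.inr (Fin.last L).succ) = 1 := ρL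
      rw [dotProduct_sub, dotProduct_single, this]
      simp [s]
    · ext i
      simp [θ, f₀]

end SimpleGraph.broom

/-! ### Padding and conclusion -/

/-- Trivial cyclic factors can be added to a product of cyclic groups. -/
def piZModSumOneEquiv {k l : ℕ} (α : Fin k → ℕ) :
    ((i : Fin k ⊕ Fin l) → ZMod (Sum.elim α 1 i)) ≃+ ((i : Fin k) → ZMod (α i)) :=
  (LinearEquiv.sumPiEquivProdPi ℤ (Fin k) (Fin l)
    fun i => ZMod (Sum.elim α 1 i)).toAddEquiv.trans
    (@AddEquiv.prodUnique _ _ _ _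
      (inferInstanceAs (Unique ((i : Fin l) → ZMod 1))))

theorem proposition7p1 {A : Type*} [AddCommGroup A] [Finite A] :
    (∀ m : ℕ, 0 < m → HasAtMostInvariantFactors A m →
      ∃ (V : Type) (_ : Fintype V) (_ : DecidableEq V) (T : SimpleGraph V)
        (_ : DecidableRel T.Adj) (S : ArithmeticalStructure T),
        T.IsBroomGraph (m + 1) ∧ Nonempty (S.CriticalGroup ≃+ A)) ∧
    (∃ (V : Type) (_ : Fintype V) (_ : DecidableEq V) (T : SimpleGraph V)
        (_ : DecidableRel T.Adj) (S : ArithmeticalStructure T),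
        T.IsTree ∧ Nonempty (S.CriticalGroup ≃+ A)) := by
  constructor
  · rintro m hm ⟨k, hk, α, hα⟩
    -- The `l` missing factors become leaves with `d = 1`, which make the number of prongs exact.
    obtain ⟨l, rfl⟩ := Nat.exists_eq_add_of_le hk
    obtain ⟨e⟩ := hα.equiv
    have hpos : ∀ i : Fin k ⊕ Fin l, 0 < Sum.elim α 1 i := by
      rintro (i | i)
      · exact two_pos.trans_le (hα.two_le i)
      · exact one_pos
    obtain ⟨L, S, ⟨e'⟩⟩ := SimpleGraph.broom.exists_arithmeticalStructure _ hpos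
    have hcard : Fintype.card (Option (Fin k ⊕ Fin l)) = k + l + 1 := by simp
    refine ⟨_, _, _, _, _, S, ?_, ⟨(e'.trans (piZModSumOneEquiv α)).trans e.symm⟩⟩
    rw [← hcard]
    exact SimpleGraph.broom.isBroomGraph (by omega)
  · classical
    obtain ⟨ι, _, n, hn, ⟨e⟩⟩ := AddCommGroup.equiv_directSum_zmod_of_finite' A
    obtain ⟨L, S, ⟨e'⟩⟩ := SimpleGraph.broom.exists_arithmeticalStructure n
      fun i => one_pos.trans (hn i)
    exact ⟨_, _, _, _, _, S, SimpleGraph.broom.isTree,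
      ⟨(e'.trans (DirectSum.addEquivProd _).symm).trans e.symm⟩⟩
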